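/- Let $X\neq\{0\}$ be a complex Banach space. A function $\varphi$ is called negative complete Bernstein ($\varphi\in\mathcal{OM}_-$) if it is holomorphic in $\mathbb{C}\setminus[0,\infty)$, satisfies $\operatorname{Im} w\cdot\operatorname{Im}\varphi(w)\ge 0$ there, and the limit $\varphi(-0)=\lim_{x\to 0-}\varphi(x)$ exists and is real. Let $\varphi\in\mathcal{OM}_-$ have the integral representation $\varphi(z)=c+bz+\int_{(0,\infty)}\frac{z}{t-z}\,d\mu(t)$, $z\in\mathbb{C}\setminus(0,\infty)$, with $b=c=0$, where $\mu$ is a positive Borel measure on $(0,\infty)$ with $\int_{(0,\infty)}\frac{d\mu(t)}{1+t}<\infty$ (in particular $\varphi(0)=0$). Let $\mathcal{NP}(X)$ be the class of closed densely defined linear operators $A$ on $X$ such that $(0,\infty)\subset\rho(A)$ and $M_A:=\sup_{t>0}\|tR(t,A)\|<\infty$, where $R(t,A)=(tI-A)^{-1}$, and for a real constant $k$ let $\mathcal{NP}_k(X)=\{A\in\mathcal{NP}(X): M_A\le k\}$. For $A\in\mathcal{NP}(X)$ let $\varphi(A)$ be the closure of the operator $x\mapsto\int_{(0,\infty)}AR(t,A)x\,d\mu(t)$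 with domain $D(A)$. Then the following statements are equivalent: 1. $\varphi$ is operator Lipschitz in every class $\mathcal{NP}_k(X)$, $k\in\mathbb{R}$: there is a constant $L$ (which may depend on $k$) such that for all $A,B\in\mathcal{NP}_k(X)$ with $D(A)\subseteq D(B)$ and $A-B$ bounded, the operator $\varphi(A)-\varphi(B)$ is bounded and $\|\varphi(A)-\varphi(B)\|\le L\|A-B\|$; 2. $\varphi'(-0):=\lim_{x\to 0-}\varphi'(x)$ is finite; 3. $\int_{(0,\infty)}\frac{d\mu(t)}{t}<\infty$; 4. there is a constant $L_1$ such that $|\varphi(x)|\le L_1|x|$ for all $x\in(-\infty,0]$; 5. $\varphi$ is Lipschitz on $(-\infty,0]$. Here a difference $S-T$ of operators has domain $D(S)\cap D(T)$; it is bounded if it is bounded on this domain, and its norm is the operator norm on this domain. -/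

import Mathlib

open MeasureTheory Filter Topology Set
open scoped ENNReal

namespace Hirsch

/-! ### Negative complete Bernstein functions -/

/-- The class `OM₋` of negative complete Bernstein functions: `φ` is holomorphic in `ℂ \ [0, ∞)`,
satisfies `Im w · Im φ(w) ≥ 0` there, and the limit `φ(-0)` along the negative reals exists and
is real. -/
structure IsNegCompleteBernstein (φ : ℂ → ℂ) : Prop where
  holomorphic : DifferentiableOn ℂ φ {z : ℂ | ∀ t : ℝ, 0 ≤ t → z ≠ (t : ℂ)}
  im_mul_im_nonneg : ∀ w : ℂ, (∀ t : ℝ, 0 ≤ t → w ≠ (t : ℂ)) → 0 ≤ w.im * (φ w).im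
  limit_neg_zero : ∃ l : ℝ, Tendsto (fun x : ℝ => φ (x : ℂ)) (𝓝[<] 0) (𝓝 (l : ℂ))

/-- The condition `∫_{(0,∞)} dμ(t) / (1 + t) < ∞` on a positive Borel measure on `(0, ∞)`. -/
def IsStieltjes (μ : Measure (Ioi (0 : ℝ))) : Prop :=
  ∫⁻ t : Ioi (0 : ℝ), ENNReal.ofReal (1 / (1 + (t : ℝ))) ∂μ < ∞

/-- The integral representation
`φ(z) = c + b z + ∫_{(0,∞)} z / (t - z) dμ(t)`, `z ∈ ℂ \ (0, ∞)`,
with `c ≤ 0`, `b ≥ 0` and a positive measure `μ` with `∫ dμ(t) / (1 + t) < ∞`.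
The point `z = 0` is included, so `φ 0 = c`. -/
structure HasRepresentation (φ : ℂ → ℂ) (c b : ℝ) (μ : Measure (Ioi (0 : ℝ))) : Prop where
  c_nonpos : c ≤ 0
  b_nonneg : 0 ≤ b
  stieltjes : IsStieltjes μ
  eq_integral : ∀ z : ℂ, (∀ t : ℝ, 0 < t → z ≠ (t : ℂ)) →
    φ z = (c : ℂ) + (b : ℂ) * z + ∫ t : Ioi (0 : ℝ), z / (((t : ℝ) : ℂ) - z) ∂μ

/-! ### Unbounded operators, resolvents and nonpositive operators -/

section Operators

variable {X : Type*} [NormedAddCommGroup X] [NormedSpace ℂ X]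

/-- The bounded operator `R` is the inverse of `z I - A : D(A) → X`. -/
structure IsResolventAt (A : X →ₗ.[ℂ] X) (z : ℂ) (R : X →L[ℂ] X) : Prop where
  mem : ∀ x, R x ∈ A.domain
  right_inv : ∀ x, z • R x - A ⟨R x, mem x⟩ = x
  left_inv : ∀ x : A.domain, R (z • (x : X) - A x) = x

/-- The resolvent set `ρ(A)`. -/
def resolventSet (A : X →ₗ.[ℂ] X) : Set ℂ := {z | ∃ R : X →L[ℂ] X, IsResolventAt A z R}

open Classical in
/-- The resolvent `R(z, A) = (z I - A)⁻¹` for `z ∈ ρ(A)` (and `0` off `ρ(A)`). -/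
noncomputable def resolventOp (A : X →ₗ.[ℂ] X) (z : ℂ) : X →L[ℂ] X :=
  if h : z ∈ resolventSet A then h.choose else 0

theorem isResolventAt_resolventOp {A : X →ₗ.[ℂ] X} {z : ℂ} (h : z ∈ resolventSet A) :
    IsResolventAt A z (resolventOp A z) := by
  rw [resolventOp, dif_pos h]
  exact h.choose_spec

/-- The class `NP(X)` of nonpositive operators: closed, densely defined operators with
`(0, ∞) ⊆ ρ(A)` and `sup_{t > 0} ‖t R(t, A)‖ < ∞`. -/
structure IsNonpositive (A : X →ₗ.[ℂ] X) : Prop where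
  isClosed : A.IsClosed
  dense_domain : Dense (A.domain : Set X)
  mem_resolventSet : ∀ t : ℝ, 0 < t → (t : ℂ) ∈ resolventSet A
  bddAbove : BddAbove (range fun t : Ioi (0 : ℝ) => ‖((t : ℝ) : ℂ) • resolventOp A ((t : ℝ) : ℂ)‖)

/-- The constant `M_A = sup_{t > 0} ‖t R(t, A)‖` (the supremum is finite for `A ∈ NP(X)`). -/
noncomputable def boundM (A : X →ₗ.[ℂ] X) : ℝ :=
  ⨆ t : Ioi (0 : ℝ), ‖((t : ℝ) : ℂ) • resolventOp A ((t : ℝ) : ℂ)‖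

/-- The class `NP_c(X) = {A ∈ NP(X) : M_A ≤ c}`. -/
def NPclass (X : Type*) [NormedAddCommGroup X] [NormedSpace ℂ X] (c : ℝ) : Set (X →ₗ.[ℂ] X) :=
  {A | IsNonpositive A ∧ boundM A ≤ c}

/-- A linear operator is bounded on its domain. -/
def IsBoundedOp (T : X →ₗ.[ℂ] X) : Prop :=
  ∃ C : ℝ, ∀ x : T.domain, ‖T x‖ ≤ C * ‖(x : X)‖

/-- The operator norm of a linear operator that is bounded on its domain. -/
noncomputable def opNorm (T : X →ₗ.[ℂ] X) : ℝ :=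
  sInf {C : ℝ | 0 ≤ C ∧ ∀ x : T.domain, ‖T x‖ ≤ C * ‖(x : X)‖}

/-! ### The functional calculus -/

/-- The integrand `t ↦ A R(t, A) x` of the functional calculus. -/
noncomputable def integrand {A : X →ₗ.[ℂ] X} (hA : IsNonpositive A) (x : X) (t : Ioi (0 : ℝ)) : X :=
  A ⟨resolventOp A ((t : ℝ) : ℂ) x,
    (isResolventAt_resolventOp (hA.mem_resolventSet t t.2)).mem x⟩

theorem integrand_eq {A : X →ₗ.[ℂ] X} (hA : IsNonpositive A) (x : X) (t : Ioi (0 : ℝ)) :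
    integrand hA x t = ((t : ℝ) : ℂ) • resolventOp A ((t : ℝ) : ℂ) x - x := by
  have h := (isResolventAt_resolventOp (hA.mem_resolventSet t t.2)).right_inv x
  rw [integrand, eq_sub_iff_add_eq]
  exact ((sub_eq_iff_eq_add.mp h).trans (add_comm _ _)).symm

theorem integrand_eq' {A : X →ₗ.[ℂ] X} (hA : IsNonpositive A) (x : A.domain) (t : Ioi (0 : ℝ)) :
    integrand hA x t = resolventOp A ((t : ℝ) : ℂ) (A x) := by
  have h := (isResolventAt_resolventOp (hA.mem_resolventSet t t.2)).left_inv x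
  rw [integrand_eq]
  rw [map_sub, map_smul] at h
  rw [sub_eq_iff_eq_add, ← sub_eq_iff_eq_add', h]

theorem norm_resolventOp_le {A : X →ₗ.[ℂ] X} (hA : IsNonpositive A) (x : X) (t : Ioi (0 : ℝ)) :
    (t : ℝ) * ‖resolventOp A ((t : ℝ) : ℂ) x‖ ≤ boundM A * ‖x‖ := by
  have h1 := le_ciSup hA.bddAbove t
  have h2 := (((t : ℝ) : ℂ) • resolventOp A ((t : ℝ) : ℂ)).le_of_opNorm_le h1 x
  have h3 : (0 : ℝ) < t := t.2
  rwa [smul_apply, norm_smul, Complex.norm_real, Real.norm_eq_abs,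
    abs_of_pos h3] at h2

theorem continuous_resolventOp {A : X →ₗ.[ℂ] X} (hA : IsNonpositive A) (x : X) :
    Continuous fun t : Ioi (0 : ℝ) => resolventOp A ((t : ℝ) : ℂ) x := by
  have key : ∀ s t : Ioi (0 : ℝ),
      resolventOp A ((t : ℝ) : ℂ) x - resolventOp A ((s : ℝ) : ℂ) x =
        resolventOp A ((t : ℝ) : ℂ)
          ((((s : ℝ) : ℂ) - ((t : ℝ) : ℂ)) • resolventOp A ((s : ℝ) : ℂ) x) := by
    intro s t
    have hs := isResolventAt_resolventOp (hA.mem_resolventSet s s.2)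
    have ht := isResolventAt_resolventOp (hA.mem_resolventSet t t.2)
    have h1 := hs.right_inv x
    have h2 := ht.left_inv ⟨_, hs.mem x⟩
    have h3 : resolventOp A ((t : ℝ) : ℂ) x = resolventOp A ((t : ℝ) : ℂ)
        (((s : ℝ) : ℂ) • resolventOp A ((s : ℝ) : ℂ) x - A ⟨_, hs.mem x⟩) := by rw [h1]
    rw [map_sub] at h2 h3
    rw [sub_smul, map_sub, h3]
    have h4 : resolventOp A ((s : ℝ) : ℂ) x =
        resolventOp A ((t : ℝ) : ℂ) (((t : ℝ) : ℂ) • resolventOp A ((s : ℝ) : ℂ) x) -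
          resolventOp A ((t : ℝ) : ℂ) (A ⟨_, hs.mem x⟩) := h2.symm
    refine (congrArg (fun v => _ - v) h4).trans ?_
    abel
  rw [continuous_iff_continuousAt]
  intro s
  rw [ContinuousAt, tendsto_iff_norm_sub_tendsto_zero]
  have hb : ∀ t : Ioi (0 : ℝ),
      ‖resolventOp A ((t : ℝ) : ℂ) x - resolventOp A ((s : ℝ) : ℂ) x‖ ≤
        boundM A * (|(s : ℝ) - t| * ‖resolventOp A ((s : ℝ) : ℂ) x‖) / t := by
    intro t
    have ht : (0 : ℝ) < t := t.2
    rw [key s t, le_div_iff₀ ht, mul_comm]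
    refine (norm_resolventOp_le hA _ t).trans (le_of_eq ?_)
    rw [norm_smul, ← Complex.ofReal_sub, Complex.norm_real, Real.norm_eq_abs]
  refine squeeze_zero (fun _ => norm_nonneg _) hb ?_
  have hc : ContinuousAt (fun t : Ioi (0 : ℝ) =>
      boundM A * (|(s : ℝ) - t| * ‖resolventOp A ((s : ℝ) : ℂ) x‖) / t) s := by
    refine ContinuousAt.div (by fun_prop) (by fun_prop) (ne_of_gt s.2)
  simpa [ContinuousAt] using hc

/-- For `x ∈ D(A)` the Bochner integral `∫ A R(t, A) x dμ(t)` converges. -/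
theorem integrable_integrand {μ : Measure (Ioi (0 : ℝ))} (hμ : IsStieltjes μ)
    {A : X →ₗ.[ℂ] X} (hA : IsNonpositive A) (x : A.domain) :
    Integrable (integrand hA (x : X)) μ := by
  have hcont : Continuous (integrand hA (x : X)) := by
    have : integrand hA (x : X) = fun t : Ioi (0 : ℝ) => resolventOp A ((t : ℝ) : ℂ) (A x) :=
      funext fun t => integrand_eq' hA x t
    rw [this]
    exact continuous_resolventOp hA _
  have hint : Integrable (fun t : Ioi (0 : ℝ) => 1 / (1 + (t : ℝ))) μ := by
    have hc : Continuous fun t : Ioi (0 : ℝ) => 1 / (1 + (t : ℝ)) := by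
      refine Continuous.div (by fun_prop) (by fun_prop) fun t => ?_
      have ht : (0 : ℝ) < t := t.2
      positivity
    refine ⟨hc.aestronglyMeasurable, ?_⟩
    rw [hasFiniteIntegral_iff_ofReal (ae_of_all _ fun t => ?_)]
    · exact hμ
    · have ht : (0 : ℝ) < t := t.2
      simp only [Pi.zero_apply]
      positivity
  refine (hint.const_mul (boundM A * ‖(x : X)‖ + ‖(x : X)‖ + boundM A * ‖A x‖)).mono'
    hcont.aestronglyMeasurable (ae_of_all _ fun t => ?_)
  have ht : (0 : ℝ) < t := t.2
  have h1 : ‖integrand hA (x : X) t‖ ≤ boundM A * ‖(x : X)‖ + ‖(x : X)‖ := by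
    rw [integrand_eq]
    refine (norm_sub_le _ _).trans ?_
    have := norm_resolventOp_le hA (x : X) t
    rw [norm_smul, Complex.norm_real, Real.norm_eq_abs, abs_of_pos ht]
    linarith
  have h2 : (t : ℝ) * ‖integrand hA (x : X) t‖ ≤ boundM A * ‖A x‖ := by
    rw [integrand_eq']
    exact norm_resolventOp_le hA _ t
  rw [mul_one_div, le_div_iff₀ (by positivity)]
  linarith

/-- The operator `x ↦ ∫_{(0,∞)} A R(t, A) x dμ(t)` with domain `D(A)`. -/
noncomputable def calculusCore {μ : Measure (Ioi (0 : ℝ))} (hμ : IsStieltjes μ)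
    {A : X →ₗ.[ℂ] X} (hA : IsNonpositive A) : X →ₗ.[ℂ] X where
  domain := A.domain
  toFun :=
    { toFun := fun x => ∫ t, integrand hA (x : X) t ∂μ
      map_add' := fun x y => by
        rw [← integral_add (integrable_integrand hμ hA x) (integrable_integrand hμ hA y)]
        congr 1
        funext t
        simp only [integrand_eq, Submodule.coe_add, map_add, smul_add]
        abel
      map_smul' := fun a x => by
        rw [RingHom.id_apply, ← integral_smul]
        congr 1
        funext t
        simp only [integrand_eq, Submodule.coe_smul, map_smul, smul_sub]
        rw [smul_comm] }

/-- The operator `φ(A)` for the function `φ ∈ OM₋` with `c = b = 0` and representing measure `μ`: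
the closure of `x ↦ ∫_{(0,∞)} A R(t, A) x dμ(t)`, `x ∈ D(A)`. -/
noncomputable def calculus {μ : Measure (Ioi (0 : ℝ))} (hμ : IsStieltjes μ)
    {A : X →ₗ.[ℂ] X} (hA : IsNonpositive A) : X →ₗ.[ℂ] X :=
  (calculusCore hμ hA).closure

/-- The function with representing measure `μ` (and `c = b = 0`) is operator Lipschitz on the class
`NP_c(X)`: for some constant `L`, whenever `A, B ∈ NP_c(X)` are such that `D(A) ⊆ D(B)` and `A - B`
is bounded, the operator `φ(A) - φ(B)` is bounded and `‖φ(A) - φ(B)‖ ≤ L ‖A - B‖`. -/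
def IsOperatorLipschitzOn (X : Type*) [NormedAddCommGroup X] [NormedSpace ℂ X]
    {μ : Measure (Ioi (0 : ℝ))} (hμ : IsStieltjes μ) (c : ℝ) : Prop :=
  ∃ L : ℝ, ∀ (A B : X →ₗ.[ℂ] X) (hA : A ∈ NPclass X c) (hB : B ∈ NPclass X c),
    A.domain ≤ B.domain → IsBoundedOp (A - B) →
      IsBoundedOp (calculus hμ hA.1 - calculus hμ hB.1) ∧
        opNorm (calculus hμ hA.1 - calculus hμ hB.1) ≤ L * opNorm (A - B)

end Operators

end Hirsch

namespace Hirsch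

/-! Everything is governed by `I = ∫ dμ(t)/t`.

If `I < ∞`: since `A R(t,A) = t R(t,A) - 1`, the integrands for `A` and `B` differ by `t (R(t,A) -
R(t,B)) = t R(t,B) (A - B) R(t,A)`, of norm at most `M_A M_B ‖A - B‖ / t` (`norm_integrand_sub_le`).
Integration gives the Lipschitz constant `k² I` on `D(A)`, and `norm_calculus_sub_le` carries the
bound over to the closures.

Conversely, the operators `a • 1` with `a ≤ 0` all lie in `NP_1(X)` and `φ(a • 1) = φ(a) • 1`, so
operator Lipschitz continuity on that one class already makes `φ` Lipschitz on `(-∞, 0]`, hence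
`|φ(x)| ≤ L₁ |x|` because `φ(0) = 0`. For `x < 0` one has `φ(x)/x = ∫ dμ(t)/(t - x)` and `φ'(x) = ∫
t/(t - x)² dμ(t)`. Both integrands tend to `1/t` as `x → 0-`, so Fatou turns a bound on either into
`I < ∞`; dominated convergence gives `φ'(-0) = I`. -/

theorem integrable_one_div_one_add {μ : Measure (Ioi (0 : ℝ))} (hμ : IsStieltjes μ) :
    Integrable (fun t : Ioi (0 : ℝ) => 1 / (1 + (t : ℝ))) μ := by
  have hpos : ∀ t : Ioi (0 : ℝ), 0 < 1 + (t : ℝ) := fun t => by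
    have ht : (0 : ℝ) < t := t.2
    positivity
  have hc : Continuous fun t : Ioi (0 : ℝ) => 1 / (1 + (t : ℝ)) :=
    Continuous.div (by fun_prop) (by fun_prop) fun t => (hpos t).ne'
  refine ⟨hc.aestronglyMeasurable, ?_⟩
  rw [hasFiniteIntegral_iff_ofReal (ae_of_all _ fun t => (one_div_pos.2 (hpos t)).le)]
  exact hμ

section Operators

variable {X : Type*} [NormedAddCommGroup X] [NormedSpace ℂ X]

/-! ### Operator norms of partially defined operators -/

theorem opNorm_nonneg (T : X →ₗ.[ℂ] X) : 0 ≤ opNorm T :=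
  Real.sInf_nonneg fun _ h => h.1

theorem opNorm_le {T : X →ₗ.[ℂ] X} {C : ℝ} (hC : 0 ≤ C)
    (h : ∀ x : T.domain, ‖T x‖ ≤ C * ‖(x : X)‖) : opNorm T ≤ C :=
  csInf_le ⟨0, fun _ h => h.1⟩ ⟨hC, h⟩

theorem IsBoundedOp.norm_le_opNorm {T : X →ₗ.[ℂ] X} (hT : IsBoundedOp T) (x : T.domain) :
    ‖T x‖ ≤ opNorm T * ‖(x : X)‖ := by
  obtain ⟨C, hC⟩ := hT
  rcases eq_or_lt_of_le (norm_nonneg (x : X)) with h0 | h0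
  · have := hC x
    rw [← h0, mul_zero] at this ⊢
    exact this
  · rw [← div_le_iff₀ h0]
    -- `opNorm` is an infimum over nonnegative bounds only, hence `max C 0`.
    refine le_csInf ⟨max C 0, le_max_right _ _, fun y => (hC y).trans ?_⟩ fun b hb => ?_
    · gcongr
      exact le_max_left _ _
    · rw [div_le_iff₀ h0]
      exact hb.2 x

/-! ### Commutation with the resolvent and closability of the core -/

theorem IsResolventAt.unique {A : X →ₗ.[ℂ] X} {z : ℂ} {R S : X →L[ℂ] X}
    (hR : IsResolventAt A z R) (hS : IsResolventAt A z S) : R = S := by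
  ext x
  have h := hR.left_inv ⟨S x, hS.mem x⟩
  rwa [hS.right_inv x] at h

/-- `resolventOp` is defined by choice; uniqueness identifies it with any explicit inverse. -/
theorem resolventOp_eq {A : X →ₗ.[ℂ] X} {z : ℂ} {R : X →L[ℂ] X} (hR : IsResolventAt A z R) :
    resolventOp A z = R :=
  (isResolventAt_resolventOp ⟨R, hR⟩).unique hR

theorem IsResolventAt.comm_apply {A : X →ₗ.[ℂ] X} {z : ℂ} {R : X →L[ℂ] X}
    (hR : IsResolventAt A z R) (x : A.domain) : R (A x) = A ⟨R x, hR.mem x⟩ := by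
  have h1 := hR.left_inv x
  have h2 := hR.right_inv (x : X)
  rw [map_sub, map_smul] at h1
  rw [sub_eq_iff_eq_add, ← sub_eq_iff_eq_add'] at h1 h2
  rw [← h1, ← h2]

theorem IsResolventAt.comm {A : X →ₗ.[ℂ] X} {z w : ℂ} {R S : X →L[ℂ] X}
    (hR : IsResolventAt A z R) (hS : IsResolventAt A w S) (x : X) : R (S x) = S (R x) := by
  have h1 : S x = z • S (R x) - A ⟨S (R x), hS.mem _⟩ := by
    have := hS.comm_apply ⟨R x, hR.mem x⟩
    rw [← this, ← map_smul, ← map_sub, hR.right_inv]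
  have h2 := hR.left_inv ⟨S (R x), hS.mem _⟩
  rw [← h1] at h2
  exact h2

theorem boundM_nonneg (A : X →ₗ.[ℂ] X) : 0 ≤ boundM A :=
  Real.iSup_nonneg fun _ => norm_nonneg _

theorem calculusCore_apply {μ : Measure (Ioi (0 : ℝ))} (hμ : IsStieltjes μ)
    {A : X →ₗ.[ℂ] X} (hA : IsNonpositive A) (x : A.domain) :
    calculusCore hμ hA x = ∫ t, integrand hA (x : X) t ∂μ := rfl

/-- The form `t R(t,A) x - x` is bounded in `t`, the form `R(t,A) A x` is `O(1/t)`; adding the two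
estimates produces the weight `1/(1+t)`. -/
theorem norm_integrand_le {A : X →ₗ.[ℂ] X} (hA : IsNonpositive A) (x : A.domain)
    (t : Ioi (0 : ℝ)) :
    ‖integrand hA (x : X) t‖ ≤
      (boundM A * ‖(x : X)‖ + ‖(x : X)‖ + boundM A * ‖A x‖) * (1 / (1 + (t : ℝ))) := by
  have ht : (0 : ℝ) < t := t.2
  have h1 : ‖integrand hA (x : X) t‖ ≤ boundM A * ‖(x : X)‖ + ‖(x : X)‖ := by
    rw [integrand_eq]
    refine (norm_sub_le _ _).trans ?_
    have := norm_resolventOp_le hA (x : X) t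
    rw [norm_smul, Complex.norm_real, Real.norm_eq_abs, abs_of_pos ht]
    linarith
  have h2 : (t : ℝ) * ‖integrand hA (x : X) t‖ ≤ boundM A * ‖A x‖ := by
    rw [integrand_eq']
    exact norm_resolventOp_le hA _ t
  rw [mul_one_div, le_div_iff₀ (by positivity)]
  linarith

theorem norm_calculusCore_le {μ : Measure (Ioi (0 : ℝ))} (hμ : IsStieltjes μ)
    {A : X →ₗ.[ℂ] X} (hA : IsNonpositive A) (x : A.domain) :
    ‖calculusCore hμ hA x‖ ≤ (boundM A * ‖(x : X)‖ + ‖(x : X)‖ + boundM A * ‖A x‖) *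
      ∫ t : Ioi (0 : ℝ), 1 / (1 + (t : ℝ)) ∂μ := by
  rw [calculusCore_apply, ← integral_const_mul]
  exact norm_integral_le_of_norm_le ((integrable_one_div_one_add hμ).const_mul _)
    (ae_of_all _ fun t => norm_integrand_le hA x t)

theorem IsResolventAt.calculusCore_comm [CompleteSpace X] {μ : Measure (Ioi (0 : ℝ))}
    (hμ : IsStieltjes μ) {A : X →ₗ.[ℂ] X} (hA : IsNonpositive A) {z : ℂ} {R : X →L[ℂ] X}
    (hR : IsResolventAt A z R) (x : A.domain) :
    R (calculusCore hμ hA x) = calculusCore hμ hA ⟨R x, hR.mem x⟩ := by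
  change R (∫ t, integrand hA (x : X) t ∂μ) = ∫ t, integrand hA (R x) t ∂μ
  rw [← R.integral_comp_comm (integrable_integrand hμ hA x)]
  congr 1
  funext t
  have ht := isResolventAt_resolventOp (hA.mem_resolventSet t t.2)
  rw [integrand_eq, integrand_eq, map_sub, map_smul, hR.comm ht]

/-- With `R = R(1,A)`, the core composed with `R` is bounded, because `R` maps `X` boundedly into
`D(A)` with the graph norm and commutes with the core. The resulting inequality `‖R v‖ ≤ C ‖u‖` on
the graph survives in its closure; `u = 0` then forces `R v = 0`, and `R` is injective. -/
theorem isClosable_calculusCore [CompleteSpace X] {μ : Measure (Ioi (0 : ℝ))}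
    (hμ : IsStieltjes μ) {A : X →ₗ.[ℂ] X} (hA : IsNonpositive A) :
    (calculusCore hμ hA).IsClosable := by
  have hR := isResolventAt_resolventOp (hA.mem_resolventSet 1 one_pos)
  set R := resolventOp A ((1 : ℝ) : ℂ)
  set I := ∫ t : Ioi (0 : ℝ), 1 / (1 + (t : ℝ)) ∂μ
  have hI : 0 ≤ I := integral_nonneg fun t => by
    have ht : (0 : ℝ) < t := t.2
    simp only [Pi.zero_apply]
    positivity
  have hM := boundM_nonneg A
  set C := (boundM A * ‖R‖ + ‖R‖ + boundM A * (‖R‖ + 1)) * I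
  have hle : ((calculusCore hμ hA).graph.topologicalClosure : Set (X × X)) ⊆
      {p : X × X | ‖R p.2‖ ≤ C * ‖p.1‖} := by
    rw [Submodule.topologicalClosure_coe]
    refine closure_minimal ?_ (isClosed_le (by fun_prop) (by fun_prop))
    rintro ⟨u, v⟩ huv
    obtain ⟨x, rfl, rfl⟩ := (LinearPMap.mem_graph_iff _).1 huv
    change ‖R (calculusCore hμ hA x)‖ ≤ C * ‖(x : X)‖
    rw [hR.calculusCore_comm hμ hA x]
    refine (norm_calculusCore_le hμ hA _).trans ?_
    have h1 : ‖R (x : X)‖ ≤ ‖R‖ * ‖(x : X)‖ := R.le_opNorm _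
    have h2 : ‖A ⟨R x, hR.mem x⟩‖ ≤ (‖R‖ + 1) * ‖(x : X)‖ := by
      have h3 := hR.right_inv (x : X)
      rw [sub_eq_iff_eq_add, ← sub_eq_iff_eq_add'] at h3
      rw [← h3]
      refine (norm_sub_le _ _).trans ?_
      rw [norm_smul, Complex.norm_real, norm_one, one_mul]
      linarith
    calc (boundM A * ‖R (x : X)‖ + ‖R (x : X)‖ + boundM A * ‖A ⟨R x, hR.mem x⟩‖) * I
        ≤ (boundM A * (‖R‖ * ‖(x : X)‖) + ‖R‖ * ‖(x : X)‖ +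
            boundM A * ((‖R‖ + 1) * ‖(x : X)‖)) * I := by gcongr
      _ = C * ‖(x : X)‖ := by simp only [C]; ring
  refine ⟨(calculusCore hμ hA).graph.topologicalClosure.toLinearPMap, ?_⟩
  rw [Submodule.toLinearPMap_graph_eq]
  rintro ⟨u, v⟩ huv (rfl : u = 0)
  have h1 : ‖R v‖ ≤ C * ‖(0 : X)‖ := hle huv
  rw [norm_zero, mul_zero, norm_le_zero_iff] at h1
  have h2 := hR.right_inv v
  have h3 : (⟨R v, hR.mem v⟩ : A.domain) = 0 := Subtype.ext h1
  rw [h3, h1, smul_zero, A.map_zero, sub_zero] at h2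
  exact h2.symm

/-- `LinearPMap.closure` returns the operator unchanged when it is not closable, so closability is
what makes `calculus` a genuine closure. -/
theorem graph_calculus [CompleteSpace X] {μ : Measure (Ioi (0 : ℝ))}
    (hμ : IsStieltjes μ) {A : X →ₗ.[ℂ] X} (hA : IsNonpositive A) :
    ((calculus hμ hA).graph : Set (X × X)) = closure ((calculusCore hμ hA).graph : Set (X × X)) := by
  rw [calculus, ← (isClosable_calculusCore hμ hA).graph_closure_eq_closure_graph,
    Submodule.topologicalClosure_coe]

/-! ### Lipschitz estimates -/

theorem norm_integrand_sub_le {A B : X →ₗ.[ℂ] X} (hA : IsNonpositive A) (hB : IsNonpositive B)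
    (hAB : A.domain ≤ B.domain) {d : ℝ} (hd : 0 ≤ d)
    (h : ∀ x : (A - B).domain, ‖(A - B) x‖ ≤ d * ‖(x : X)‖) (x : X) (t : Ioi (0 : ℝ)) :
    ‖integrand hA x t - integrand hB x t‖ ≤ boundM B * boundM A * d * ‖x‖ * (1 / (t : ℝ)) := by
  have ht : (0 : ℝ) < t := t.2
  have hRA := isResolventAt_resolventOp (hA.mem_resolventSet t t.2)
  have hRB := isResolventAt_resolventOp (hB.mem_resolventSet t t.2)
  rw [integrand_eq, integrand_eq, sub_sub_sub_cancel_right, ← smul_sub]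
  set R := resolventOp A ((t : ℝ) : ℂ)
  set S := resolventOp B ((t : ℝ) : ℂ)
  have hmem : R x ∈ (A - B).domain := ⟨hRA.mem x, hAB (hRA.mem x)⟩
  -- Second resolvent identity; `D(A) ⊆ D(B)` lets `B` act on the range of `R`.
  have key : R x - S x = S ((A - B) ⟨R x, hmem⟩) := by
    have h1 := hRB.left_inv ⟨R x, hAB (hRA.mem x)⟩
    have h2 := congrArg S (hRA.right_inv x)
    rw [LinearPMap.sub_apply, map_sub]
    rw [map_sub] at h1 h2
    exact (congrArg₂ (· - ·) h1.symm h2.symm).trans (sub_sub_sub_cancel_left _ _ _)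
  rw [key, norm_smul, Complex.norm_real, Real.norm_eq_abs, abs_of_pos ht]
  refine (norm_resolventOp_le hB _ t).trans ?_
  have h1 : ‖R x‖ ≤ boundM A * ‖x‖ * (1 / (t : ℝ)) := by
    rw [mul_one_div, le_div_iff₀ ht, mul_comm]
    exact norm_resolventOp_le hA x t
  have hM := boundM_nonneg B
  calc boundM B * ‖(A - B) ⟨R x, hmem⟩‖ ≤ boundM B * (d * (boundM A * ‖x‖ * (1 / (t : ℝ)))) := by
        gcongr
        exact (h ⟨R x, hmem⟩).trans (by gcongr)
    _ = _ := by ring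

theorem norm_calculusCore_sub_le {μ : Measure (Ioi (0 : ℝ))} (hμ : IsStieltjes μ)
    (hint : Integrable (fun t : Ioi (0 : ℝ) => 1 / (t : ℝ)) μ)
    {A B : X →ₗ.[ℂ] X} (hA : IsNonpositive A) (hB : IsNonpositive B)
    (hAB : A.domain ≤ B.domain) {d : ℝ} (hd : 0 ≤ d)
    (h : ∀ x : (A - B).domain, ‖(A - B) x‖ ≤ d * ‖(x : X)‖) (x : A.domain) :
    ‖calculusCore hμ hA x - calculusCore hμ hB ⟨x, hAB x.2⟩‖ ≤
      boundM B * boundM A * d * (∫ t : Ioi (0 : ℝ), 1 / (t : ℝ) ∂μ) * ‖(x : X)‖ := by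
  change ‖∫ t, integrand hA (x : X) t ∂μ - ∫ t, integrand hB (x : X) t ∂μ‖ ≤ _
  rw [← integral_sub (integrable_integrand hμ hA x) (integrable_integrand hμ hB ⟨x, hAB x.2⟩),
    mul_right_comm, ← integral_const_mul]
  exact norm_integral_le_of_norm_le (hint.const_mul _)
    (ae_of_all _ fun t => norm_integrand_sub_le hA hB hAB hd h x t)

/-- Approximate `(x, φ(A)x)` by points `u n` of the graph of the core. The bound makes the
differences of the cores at `u n` Cauchy, so the core of `B` converges along the same sequence, and
its limit must be `φ(B)x`. -/
theorem norm_calculus_sub_le [CompleteSpace X] {μ : Measure (Ioi (0 : ℝ))} (hμ : IsStieltjes μ)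
    {A B : X →ₗ.[ℂ] X} (hA : IsNonpositive A) (hB : IsNonpositive B)
    (hAB : A.domain ≤ B.domain) {K : ℝ} (h : ∀ x : A.domain,
      ‖calculusCore hμ hA x - calculusCore hμ hB ⟨x, hAB x.2⟩‖ ≤ K * ‖(x : X)‖)
    (x : (calculus hμ hA - calculus hμ hB).domain) :
    ‖(calculus hμ hA - calculus hμ hB) x‖ ≤ K * ‖(x : X)‖ := by
  have hx : ((x : X), calculus hμ hA ⟨x, x.2.1⟩) ∈
      closure ((calculusCore hμ hA).graph : Set (X × X)) := by
    rw [← graph_calculus]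
    exact (calculus hμ hA).mem_graph ⟨x, x.2.1⟩
  obtain ⟨p, hp, hlim⟩ := mem_closure_iff_seq_limit.1 hx
  choose u hu1 hu2 using fun n => (LinearPMap.mem_graph_iff _).1 (hp n)
  have hu : Tendsto (fun n => (u n : X)) atTop (𝓝 (x : X)) := by
    simp only [hu1]
    exact (continuous_fst.tendsto _).comp hlim
  have hAu : Tendsto (fun n => calculusCore hμ hA (u n)) atTop
      (𝓝 (calculus hμ hA ⟨x, x.2.1⟩)) := by
    simp only [hu2]
    exact (continuous_snd.tendsto _).comp hlim
  set w : ℕ → X := fun n =>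
    calculusCore hμ hA (u n) - calculusCore hμ hB ⟨u n, hAB (u n).2⟩ with hw
  have hsub : ∀ m n, ‖w m - w n‖ ≤ K * ‖(u m : X) - u n‖ := fun m n => by
    have h1 := h (u m - u n)
    have h3 := (calculusCore hμ hA).map_sub (u m) (u n)
    have h4 := (calculusCore hμ hB).map_sub ⟨u m, hAB (u m).2⟩ ⟨u n, hAB (u n).2⟩
    have h5 : w m - w n = calculusCore hμ hA (u m - u n) -
        calculusCore hμ hB (⟨u m, hAB (u m).2⟩ - ⟨u n, hAB (u n).2⟩) :=
      (sub_sub_sub_comm _ _ _ _).trans (congrArg₂ (· - ·) h3.symm h4.symm)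
    rw [h5]
    exact h1
  have hcauchy : CauchySeq w := by
    rw [Metric.cauchySeq_iff']
    intro ε hε
    -- `K` has no prescribed sign and may vanish; `|K| + 1` is a positive majorant.
    obtain ⟨N, hN⟩ := Metric.cauchySeq_iff'.1 hu.cauchySeq (ε / (|K| + 1)) (by positivity)
    refine ⟨N, fun n hn => ?_⟩
    have h1 := hN n hn
    rw [dist_eq_norm, lt_div_iff₀ (by positivity)] at h1
    rw [dist_eq_norm]
    refine (hsub n N).trans_lt (lt_of_le_of_lt ?_ h1)
    rw [mul_comm]
    gcongr
    linarith [le_abs_self K]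
  obtain ⟨v, hv⟩ := cauchySeq_tendsto_of_complete hcauchy
  have hBu : Tendsto (fun n => calculusCore hμ hB ⟨u n, hAB (u n).2⟩) atTop
      (𝓝 (calculus hμ hA ⟨x, x.2.1⟩ - v)) := by
    have := hAu.sub hv
    simpa only [hw, sub_sub_cancel] using this
  have hmem : ((x : X), calculus hμ hA ⟨x, x.2.1⟩ - v) ∈
      ((calculus hμ hB).graph : Set (X × X)) := by
    rw [graph_calculus]
    exact mem_closure_of_tendsto (hu.prodMk_nhds hBu)
      (Eventually.of_forall fun n => (calculusCore hμ hB).mem_graph ⟨u n, hAB (u n).2⟩)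
  have hB' : calculus hμ hB ⟨x, x.2.2⟩ = calculus hμ hA ⟨x, x.2.1⟩ - v :=
    (calculus hμ hB).mem_graph_snd_inj ((calculus hμ hB).mem_graph ⟨x, x.2.2⟩) hmem rfl
  have hval : (calculus hμ hA - calculus hμ hB) x = v := by
    rw [LinearPMap.sub_apply]
    refine (congrArg (fun y => _ - y) hB').trans (sub_sub_cancel _ _)
  rw [hval]
  exact le_of_tendsto_of_tendsto' hv.norm (hu.norm.const_mul K) fun n => h (u n)

theorem isOperatorLipschitzOn_of_integrable [CompleteSpace X] {μ : Measure (Ioi (0 : ℝ))}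
    (hμ : IsStieltjes μ) (hint : Integrable (fun t : Ioi (0 : ℝ) => 1 / (t : ℝ)) μ) (c : ℝ) :
    IsOperatorLipschitzOn X hμ c := by
  refine ⟨c * c * ∫ t : Ioi (0 : ℝ), 1 / (t : ℝ) ∂μ, fun A B hA hB hAB hbdd => ?_⟩
  have hI : 0 ≤ ∫ t : Ioi (0 : ℝ), 1 / (t : ℝ) ∂μ := integral_nonneg fun t => by
    have ht : (0 : ℝ) < t := t.2
    simp only [Pi.zero_apply]
    positivity
  have hd := opNorm_nonneg (A - B)
  -- For negative `c` the class is empty; its member `A` supplies the sign.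
  have hc : 0 ≤ c := (boundM_nonneg A).trans hA.2
  have hbound := norm_calculus_sub_le hμ hA.1 hB.1 hAB
    (K := c * c * (∫ t : Ioi (0 : ℝ), 1 / (t : ℝ) ∂μ) * opNorm (A - B)) fun x => by
      refine (norm_calculusCore_sub_le hμ hint hA.1 hB.1 hAB hd hbdd.norm_le_opNorm x).trans ?_
      rw [mul_right_comm _ (opNorm (A - B))]
      have := boundM_nonneg A
      gcongr
      · exact hB.2
      · exact hA.2
  exact ⟨⟨_, hbound⟩, opNorm_le (by positivity) hbound⟩

/-! ### Scalar operators -/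

/-- The everywhere defined operator `x ↦ a x`. -/
noncomputable def scalarOp (X : Type*) [NormedAddCommGroup X] [NormedSpace ℂ X] (a : ℝ) :
    X →ₗ.[ℂ] X :=
  LinearMap.toPMap ((a : ℂ) • LinearMap.id) ⊤

theorem scalarOp_apply (a : ℝ) (x : (scalarOp X a).domain) : scalarOp X a x = (a : ℂ) • (x : X) :=
  rfl

theorem isResolventAt_scalarOp {a : ℝ} (ha : a ≤ 0) {t : ℝ} (ht : 0 < t) :
    IsResolventAt (scalarOp X a) (t : ℂ) (((t : ℂ) - a)⁻¹ • ContinuousLinearMap.id ℂ X) := by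
  have hne : (t : ℂ) - a ≠ 0 := by
    rw [← Complex.ofReal_sub, Complex.ofReal_ne_zero]
    linarith
  refine ⟨fun x => trivial, fun x => ?_, fun x => ?_⟩
  · rw [scalarOp_apply, ← sub_smul, smul_apply, ContinuousLinearMap.id_apply, smul_smul,
      mul_inv_cancel₀ hne, one_smul]
  · rw [scalarOp_apply, ← sub_smul, smul_apply, ContinuousLinearMap.id_apply, smul_smul,
      inv_mul_cancel₀ hne, one_smul]

/-- The factor is `t/(t - a) ∈ (0, 1]`, uniformly in `a ≤ 0`. -/
theorem norm_smul_resolventOp_scalarOp_le {a : ℝ} (ha : a ≤ 0) (t : Ioi (0 : ℝ)) :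
    ‖((t : ℝ) : ℂ) • resolventOp (scalarOp X a) ((t : ℝ) : ℂ)‖ ≤ 1 := by
  have ht : (0 : ℝ) < t := t.2
  rw [resolventOp_eq (isResolventAt_scalarOp ha ht), smul_smul, norm_smul]
  refine mul_le_one₀ ?_ (norm_nonneg _) ContinuousLinearMap.norm_id_le
  rw [← Complex.ofReal_sub, ← Complex.ofReal_inv, ← Complex.ofReal_mul, Complex.norm_real,
    Real.norm_eq_abs, ← div_eq_mul_inv, abs_of_nonneg (div_nonneg ht.le (by linarith)),
    div_le_one (by linarith)]
  linarith

theorem scalarOp_mem_NPclass {a : ℝ} (ha : a ≤ 0) : scalarOp X a ∈ NPclass X 1 := by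
  have hb := norm_smul_resolventOp_scalarOp_le (X := X) ha
  have : Nonempty (Ioi (0 : ℝ)) := ⟨⟨1, mem_Ioi.2 one_pos⟩⟩
  refine ⟨⟨?_, dense_univ, fun t ht => ⟨_, isResolventAt_scalarOp ha ht⟩, ⟨1, ?_⟩⟩, ciSup_le hb⟩
  · have : ((scalarOp X a).graph : Set (X × X)) = {p : X × X | p.2 = (a : ℂ) • p.1} := by
      ext ⟨u, v⟩
      simp only [SetLike.mem_coe, LinearPMap.mem_graph_iff, mem_ofPred_eq]
      constructor
      · rintro ⟨y, rfl, rfl⟩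
        exact scalarOp_apply a y
      · intro h
        exact ⟨⟨u, trivial⟩, rfl, h.symm⟩
    rw [LinearPMap.IsClosed, this]
    exact isClosed_eq (by fun_prop) (by fun_prop)
  · rintro _ ⟨t, rfl⟩
    exact hb t

theorem calculus_apply_of_mem {μ : Measure (Ioi (0 : ℝ))} (hμ : IsStieltjes μ)
    {A : X →ₗ.[ℂ] X} (hA : IsNonpositive A) (x : A.domain) :
    calculus hμ hA ⟨x, (calculusCore hμ hA).le_closure.1 x.2⟩ = calculusCore hμ hA x :=
  ((calculusCore hμ hA).le_closure.2 rfl).symm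

/-- The scalar identity `t/(t - a) - 1 = a/(t - a)` recovers the kernel of `φ`. -/
theorem calculusCore_scalarOp [CompleteSpace X] {φ : ℂ → ℂ} {μ : Measure (Ioi (0 : ℝ))}
    (hφ : HasRepresentation φ 0 0 μ) {a : ℝ} (ha : a ≤ 0) (hA : IsNonpositive (scalarOp X a))
    (x : (scalarOp X a).domain) :
    calculusCore hφ.stieltjes hA x = φ a • (x : X) := by
  have hne : ∀ t : ℝ, 0 < t → (t : ℂ) - a ≠ 0 := fun t ht => by
    rw [← Complex.ofReal_sub, Complex.ofReal_ne_zero]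
    linarith
  rw [calculusCore_apply, hφ.eq_integral a fun t ht h => hne t ht (by rw [h, sub_self])]
  rw [Complex.ofReal_zero, zero_mul, zero_add, zero_add, ← integral_smul_const]
  congr 1
  funext t
  have h0 := hne t t.2
  rw [integrand_eq, resolventOp_eq (isResolventAt_scalarOp ha t.2), smul_apply,
    ContinuousLinearMap.id_apply, smul_smul]
  nth_rewrite 2 [← one_smul ℂ (x : X)]
  rw [← sub_smul]
  congr 1
  field_simp
  ring

theorem exists_lipschitzOnWith_of_isOperatorLipschitzOn [CompleteSpace X] [Nontrivial X]
    {φ : ℂ → ℂ} {μ : Measure (Ioi (0 : ℝ))} (hφ : HasRepresentation φ 0 0 μ)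
    (h : IsOperatorLipschitzOn X hφ.stieltjes 1) :
    ∃ K : NNReal, LipschitzOnWith K (fun x : ℝ => φ (x : ℂ)) (Iic 0) := by
  obtain ⟨L, hL⟩ := h
  refine ⟨L.toNNReal, LipschitzOnWith.of_dist_le_mul fun a ha b hb => ?_⟩
  have hA := scalarOp_mem_NPclass (X := X) ha
  have hB := scalarOp_mem_NPclass (X := X) hb
  have hsub : ∀ x : (scalarOp X a - scalarOp X b).domain,
      ‖(scalarOp X a - scalarOp X b) x‖ ≤ |a - b| * ‖(x : X)‖ := fun x => by
    rw [LinearPMap.sub_apply, scalarOp_apply, scalarOp_apply, ← sub_smul, norm_smul,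
      ← Complex.ofReal_sub, Complex.norm_real, Real.norm_eq_abs]
  obtain ⟨hbdd, hle⟩ := hL _ _ hA hB le_rfl ⟨_, hsub⟩
  obtain ⟨v, hv⟩ := exists_ne (0 : X)
  have hvA := (calculusCore hφ.stieltjes hA.1).le_closure.1
    (show v ∈ (scalarOp X a).domain from trivial)
  have hvB := (calculusCore hφ.stieltjes hB.1).le_closure.1
    (show v ∈ (scalarOp X b).domain from trivial)
  have h1 := hbdd.norm_le_opNorm ⟨v, hvA, hvB⟩
  have h2 : (calculus hφ.stieltjes hA.1 - calculus hφ.stieltjes hB.1) ⟨v, hvA, hvB⟩ =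
      (φ a - φ b) • v := by
    rw [LinearPMap.sub_apply, sub_smul, ← calculusCore_scalarOp hφ ha hA.1 ⟨v, trivial⟩,
      ← calculusCore_scalarOp hφ hb hB.1 ⟨v, trivial⟩, ← calculus_apply_of_mem,
      ← calculus_apply_of_mem]
  -- Cancelling `‖v‖` with `v ≠ 0` leaves the scalar estimate.
  rw [h2, norm_smul, mul_le_mul_iff_left₀ (norm_pos_iff.2 hv)] at h1
  rw [dist_eq_norm, Real.dist_eq, Real.coe_toNNReal']
  refine (h1.trans hle).trans ?_
  have := opNorm_nonneg (scalarOp X a - scalarOp X b)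
  gcongr
  · exact le_max_left _ _
  · exact opNorm_le (abs_nonneg _) hsub

end Operators
/-! ### Estimates for the scalar function -/

section Scalar

variable {φ : ℂ → ℂ} {μ : Measure (Ioi (0 : ℝ))}

theorem lintegral_ofReal_lt_top_iff_integrable :
    ∫⁻ t : Ioi (0 : ℝ), ENNReal.ofReal (1 / (t : ℝ)) ∂μ < ∞ ↔
      Integrable (fun t : Ioi (0 : ℝ) => 1 / (t : ℝ)) μ := by
  have hm : AEStronglyMeasurable (fun t : Ioi (0 : ℝ) => 1 / (t : ℝ)) μ :=
    (by fun_prop : Measurable fun t : Ioi (0 : ℝ) => 1 / (t : ℝ)).aestronglyMeasurable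
  rw [Integrable, and_iff_right hm,
    hasFiniteIntegral_iff_ofReal (ae_of_all _ fun t => (one_div_pos.2 t.2).le)]

/-- Fatou's lemma as `x → 0-`, shared by the kernels of `φ(x)/x` and `φ'(x)`. -/
theorem lintegral_lt_top_of_tendsto {f : ℝ → Ioi (0 : ℝ) → ℝ} (hm : ∀ x, Measurable (f x))
    (hf : ∀ x < 0, Integrable (f x) μ) (hnn : ∀ x < 0, ∀ t, 0 ≤ f x t)
    (hlim : ∀ t : Ioi (0 : ℝ), Tendsto (fun x => f x t) (𝓝[<] 0) (𝓝 (1 / (t : ℝ))))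
    {C : ℝ} (hC : ∀ᶠ x in 𝓝[<] (0 : ℝ), ∫ t, f x t ∂μ ≤ C) :
    ∫⁻ t : Ioi (0 : ℝ), ENNReal.ofReal (1 / (t : ℝ)) ∂μ < ∞ := by
  calc ∫⁻ t : Ioi (0 : ℝ), ENNReal.ofReal (1 / (t : ℝ)) ∂μ
      = ∫⁻ t, liminf (fun x => ENNReal.ofReal (f x t)) (𝓝[<] 0) ∂μ :=
        lintegral_congr fun t => ((ENNReal.tendsto_ofReal (hlim t)).liminf_eq).symm
    _ ≤ liminf (fun x => ∫⁻ t, ENNReal.ofReal (f x t) ∂μ) (𝓝[<] 0) :=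
        lintegral_liminf_le fun x => (hm x).ennreal_ofReal
    _ ≤ liminf (fun _ => ENNReal.ofReal C) (𝓝[<] (0 : ℝ)) := by
        refine liminf_le_liminf ?_
        filter_upwards [hC, self_mem_nhdsWithin] with x hx hx0
        rw [← ofReal_integral_eq_lintegral_ofReal (hf x hx0) (ae_of_all _ (hnn x hx0))]
        exact ENNReal.ofReal_le_ofReal hx
    _ = ENNReal.ofReal C := liminf_const _
    _ < ∞ := ENNReal.ofReal_lt_top

theorem one_div_sub_le {x : ℝ} (hx : x < 0) (t : Ioi (0 : ℝ)) :
    1 / ((t : ℝ) - x) ≤ (1 + 1 / (-x)) * (1 / (1 + (t : ℝ))) := by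
  have ht : (0 : ℝ) < t := t.2
  rw [mul_one_div, div_le_div_iff₀ (by linarith) (by linarith), one_mul]
  have h1 : 1 / (-x) * (-x) = 1 := one_div_mul_cancel (by linarith)
  have h2 : 0 < 1 / (-x) * t := mul_pos (one_div_pos.2 (by linarith)) ht
  -- The product `(1 + 1/(-x)) (t - x)` expands to `t - x + t/(-x) + 1 ≥ 1 + t`.
  nlinarith

theorem integrable_one_div_sub (hμ : IsStieltjes μ) {x : ℝ} (hx : x < 0) :
    Integrable (fun t : Ioi (0 : ℝ) => 1 / ((t : ℝ) - x)) μ := by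
  refine ((integrable_one_div_one_add hμ).const_mul (1 + 1 / (-x))).mono'
    (by fun_prop : Measurable fun t : Ioi (0 : ℝ) => 1 / ((t : ℝ) - x)).aestronglyMeasurable
    (ae_of_all _ fun t => ?_)
  have ht : (0 : ℝ) < t := t.2
  rw [Real.norm_of_nonneg (one_div_nonneg.2 (by linarith))]
  exact one_div_sub_le hx t

theorem div_sub_sq_le {x : ℝ} (hx : x < 0) (t : Ioi (0 : ℝ)) :
    (t : ℝ) / ((t : ℝ) - x) ^ 2 ≤ 1 / ((t : ℝ) - x) := by
  have ht : (0 : ℝ) < t := t.2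
  rw [div_le_div_iff₀ (by nlinarith) (by linarith)]
  nlinarith

theorem integrable_div_sub_sq (hμ : IsStieltjes μ) {x : ℝ} (hx : x < 0) :
    Integrable (fun t : Ioi (0 : ℝ) => (t : ℝ) / ((t : ℝ) - x) ^ 2) μ := by
  refine (integrable_one_div_sub hμ hx).mono'
    (by fun_prop : Measurable fun t : Ioi (0 : ℝ) =>
      (t : ℝ) / ((t : ℝ) - x) ^ 2).aestronglyMeasurable (ae_of_all _ fun t => ?_)
  have ht : (0 : ℝ) < t := t.2
  rw [Real.norm_of_nonneg (by positivity)]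
  exact div_sub_sq_le hx t

theorem HasRepresentation.apply_of_neg (hφ : HasRepresentation φ 0 0 μ) {x : ℝ} (hx : x < 0) :
    φ x = ((x * ∫ t : Ioi (0 : ℝ), 1 / ((t : ℝ) - x) ∂μ : ℝ) : ℂ) := by
  rw [hφ.eq_integral x fun t ht h => by
    have := Complex.ofReal_injective h
    linarith]
  rw [Complex.ofReal_zero, zero_mul, zero_add, zero_add, ← integral_const_mul,
    ← integral_complex_ofReal]
  congr 1
  funext t
  push_cast
  ring

theorem HasRepresentation.apply_zero (hφ : HasRepresentation φ 0 0 μ) : φ (0 : ℝ) = 0 := by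
  rw [hφ.eq_integral _ fun t ht h => ht.ne (Complex.ofReal_injective h)]
  simp

/-- Differentiation under the integral on the half-plane `Re z < x/2`, where `|t - z| ≥ t - x/2`
bounds the kernel's derivative `t/(t - z)²` uniformly in `z`. -/
theorem HasRepresentation.deriv_of_neg (hφ : HasRepresentation φ 0 0 μ) {x : ℝ} (hx : x < 0) :
    deriv φ x = ((∫ t : Ioi (0 : ℝ), (t : ℝ) / ((t : ℝ) - x) ^ 2 ∂μ : ℝ) : ℂ) := by
  have hx2 : x / 2 < 0 := by linarith
  have hs : {z : ℂ | z.re < x / 2} ∈ 𝓝 (x : ℂ) :=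
    (isOpen_lt Complex.continuous_re continuous_const).mem_nhds
      (by simp only [mem_ofPred_eq, Complex.ofReal_re]; linarith)
  have hre : ∀ (t : Ioi (0 : ℝ)) (z : ℂ), z.re < x / 2 → (t : ℝ) - x / 2 ≤ ‖((t : ℝ) : ℂ) - z‖ :=
    fun t z hz => by
      refine le_trans ?_ (Complex.re_le_norm _)
      rw [Complex.sub_re, Complex.ofReal_re]
      linarith
  have hpos : ∀ t : Ioi (0 : ℝ), 0 < (t : ℝ) - x / 2 := fun t => by
    have ht : (0 : ℝ) < t := t.2
    linarith
  have hne : ∀ (t : Ioi (0 : ℝ)) (z : ℂ), z.re < x / 2 → ((t : ℝ) : ℂ) - z ≠ 0 :=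
    fun t z hz => norm_pos_iff.1 ((hpos t).trans_le (hre t z hz))
  have hmeas : ∀ z : ℂ, Measurable fun t : Ioi (0 : ℝ) => z / (((t : ℝ) : ℂ) - z) := fun z => by
    fun_prop
  have hint : Integrable (fun t : Ioi (0 : ℝ) => (x : ℂ) / (((t : ℝ) : ℂ) - x)) μ := by
    refine ((integrable_one_div_sub hφ.stieltjes hx).const_mul |x|).mono'
      (hmeas x).aestronglyMeasurable (ae_of_all _ fun t => ?_)
    have ht : (0 : ℝ) < t := t.2
    rw [← Complex.ofReal_sub, norm_div, Complex.norm_real, Complex.norm_real, mul_one_div,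
      Real.norm_eq_abs, Real.norm_of_nonneg (by linarith : 0 ≤ (t : ℝ) - x)]
  have key := hasDerivAt_integral_of_dominated_loc_of_deriv_le (μ := μ) (x₀ := (x : ℂ)) (𝕜 := ℂ)
    (F := fun z (t : Ioi (0 : ℝ)) => z / (((t : ℝ) : ℂ) - z))
    (F' := fun z (t : Ioi (0 : ℝ)) => ((t : ℝ) : ℂ) / (((t : ℝ) : ℂ) - z) ^ 2)
    (bound := fun t : Ioi (0 : ℝ) => (t : ℝ) / ((t : ℝ) - x / 2) ^ 2) hs
    (Eventually.of_forall fun z => (hmeas z).aestronglyMeasurable) hint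
    (by fun_prop : Measurable fun t : Ioi (0 : ℝ) =>
      ((t : ℝ) : ℂ) / (((t : ℝ) : ℂ) - x) ^ 2).aestronglyMeasurable
    (ae_of_all _ fun t z hz => by
      have ht : (0 : ℝ) < t := t.2
      have := hre t z hz
      have := hpos t
      rw [norm_div, norm_pow, Complex.norm_real, Real.norm_of_nonneg ht.le]
      gcongr)
    (integrable_div_sub_sq hφ.stieltjes hx2)
    (ae_of_all _ fun t z hz => by
      have h := (hasDerivAt_id z).div ((hasDerivAt_id z).const_sub ((t : ℝ) : ℂ)) (hne t z hz)
      refine h.congr_deriv ?_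
      simp only [id]
      congr 1
      ring)
  have heq : φ =ᶠ[𝓝 (x : ℂ)] fun z => ∫ t : Ioi (0 : ℝ), z / (((t : ℝ) : ℂ) - z) ∂μ := by
    filter_upwards [hs] with z hz
    rw [hφ.eq_integral z fun t ht h => hne ⟨t, ht⟩ z hz (by rw [h, sub_self])]
    simp
  rw [heq.deriv_eq, key.2.deriv, ← integral_complex_ofReal]
  congr 1
  funext t
  push_cast
  rfl

theorem lintegral_lt_top_of_norm_le (hφ : HasRepresentation φ 0 0 μ) {L : ℝ}
    (h : ∀ x : ℝ, x ≤ 0 → ‖φ (x : ℂ)‖ ≤ L * |x|) :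
    ∫⁻ t : Ioi (0 : ℝ), ENNReal.ofReal (1 / (t : ℝ)) ∂μ < ∞ := by
  refine lintegral_lt_top_of_tendsto (f := fun x t => 1 / ((t : ℝ) - x)) (fun x => by fun_prop)
    (fun x => integrable_one_div_sub hφ.stieltjes) (fun x hx t => ?_) (fun t => ?_) (C := L) ?_
  · have ht : (0 : ℝ) < t := t.2
    exact one_div_nonneg.2 (by linarith)
  · have hc : ContinuousAt (fun x : ℝ => 1 / ((t : ℝ) - x)) 0 :=
      ContinuousAt.div (by fun_prop) (by fun_prop) (by simpa using (ne_of_gt t.2))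
    have := hc.tendsto.mono_left (nhdsWithin_le_nhds (s := Iio 0))
    simpa using this
  · filter_upwards [self_mem_nhdsWithin] with x (hx : x < 0)
    have h1 := h x hx.le
    rw [hφ.apply_of_neg hx, Complex.norm_real, norm_mul, Real.norm_eq_abs, mul_comm] at h1
    exact (Real.le_norm_self _).trans (le_of_mul_le_mul_right h1 (abs_pos.2 hx.ne))

theorem tendsto_div_sub_sq (t : Ioi (0 : ℝ)) :
    Tendsto (fun x : ℝ => (t : ℝ) / ((t : ℝ) - x) ^ 2) (𝓝[<] 0) (𝓝 (1 / (t : ℝ))) := by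
  have ht : (t : ℝ) ≠ 0 := ne_of_gt t.2
  have hc : ContinuousAt (fun x : ℝ => (t : ℝ) / ((t : ℝ) - x) ^ 2) 0 :=
    ContinuousAt.div (by fun_prop) (by fun_prop) (by simpa using ht)
  have := hc.tendsto.mono_left (nhdsWithin_le_nhds (s := Iio 0))
  convert this using 2
  field_simp
  simp

theorem lintegral_lt_top_of_tendsto_deriv (hφ : HasRepresentation φ 0 0 μ) {l : ℝ}
    (h : Tendsto (fun x : ℝ => deriv φ (x : ℂ)) (𝓝[<] 0) (𝓝 (l : ℂ))) :
    ∫⁻ t : Ioi (0 : ℝ), ENNReal.ofReal (1 / (t : ℝ)) ∂μ < ∞ := by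
  -- Any constant above `l` eventually bounds `φ'(x)`; hence `l + 1`.
  refine lintegral_lt_top_of_tendsto (f := fun x t => (t : ℝ) / ((t : ℝ) - x) ^ 2)
    (fun x => by fun_prop) (fun x => integrable_div_sub_sq hφ.stieltjes) (fun x hx t => ?_)
    tendsto_div_sub_sq (C := l + 1) ?_
  · have ht : (0 : ℝ) < t := t.2
    positivity
  · have h1 : Tendsto (fun x : ℝ => (deriv φ (x : ℂ)).re) (𝓝[<] 0) (𝓝 l) :=
      (Complex.continuous_re.tendsto (l : ℂ)).comp h
    filter_upwards [self_mem_nhdsWithin, h1.eventually_le_const (lt_add_one l)] with x hx hle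
    rwa [hφ.deriv_of_neg hx, Complex.ofReal_re] at hle

theorem tendsto_deriv_of_integrable (hφ : HasRepresentation φ 0 0 μ)
    (hint : Integrable (fun t : Ioi (0 : ℝ) => 1 / (t : ℝ)) μ) :
    Tendsto (fun x : ℝ => deriv φ (x : ℂ)) (𝓝[<] 0)
      (𝓝 ((∫ t : Ioi (0 : ℝ), 1 / (t : ℝ) ∂μ : ℝ) : ℂ)) := by
  have h : Tendsto (fun x : ℝ => ∫ t : Ioi (0 : ℝ), (t : ℝ) / ((t : ℝ) - x) ^ 2 ∂μ) (𝓝[<] 0)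
      (𝓝 (∫ t : Ioi (0 : ℝ), 1 / (t : ℝ) ∂μ)) := by
    refine tendsto_integral_filter_of_dominated_convergence _
      (Eventually.of_forall fun x => (by fun_prop : Measurable fun t : Ioi (0 : ℝ) =>
        (t : ℝ) / ((t : ℝ) - x) ^ 2).aestronglyMeasurable) ?_ hint
      (ae_of_all _ tendsto_div_sub_sq)
    filter_upwards [self_mem_nhdsWithin] with x (hx : x < 0)
    refine ae_of_all _ fun t => ?_
    have ht : (0 : ℝ) < t := t.2
    rw [Real.norm_of_nonneg (by positivity)]
    -- `t/(t - x)² ≤ 1/(t - x) ≤ 1/t`, an integrable majorant independent of `x`.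
    refine (div_sub_sq_le hx t).trans ?_
    gcongr
    linarith
  refine ((Complex.continuous_ofReal.tendsto _).comp h).congr' ?_
  filter_upwards [self_mem_nhdsWithin] with x hx
  exact (hφ.deriv_of_neg hx).symm

end Scalar

end Hirsch

/-! ### The equivalences -/

theorem corollary3p2 (X : Type*) [NormedAddCommGroup X] [NormedSpace ℂ X] [CompleteSpace X]
    [Nontrivial X] (φ : ℂ → ℂ) (hφ : Hirsch.IsNegCompleteBernstein φ)
    (μ : Measure (Ioi (0 : ℝ))) (hμ : Hirsch.HasRepresentation φ 0 0 μ) :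
    List.TFAE [
      ∀ c : ℝ, Hirsch.IsOperatorLipschitzOn X hμ.stieltjes c,
      ∃ l : ℝ, Tendsto (fun x : ℝ => deriv φ (x : ℂ)) (𝓝[<] 0) (𝓝 (l : ℂ)),
      ∫⁻ t : Ioi (0 : ℝ), ENNReal.ofReal (1 / (t : ℝ)) ∂μ < ∞,
      ∃ L : ℝ, ∀ x : ℝ, x ≤ 0 → ‖φ (x : ℂ)‖ ≤ L * |x|,
      ∃ K : NNReal, LipschitzOnWith K (fun x : ℝ => φ (x : ℂ)) (Iic 0)] := by
  -- The class with constant `1` suffices, as it contains every scalar operator used.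
  tfae_have 1 → 5 := fun h => Hirsch.exists_lipschitzOnWith_of_isOperatorLipschitzOn hμ (h 1)
  tfae_have 5 → 4 := by
    rintro ⟨K, hK⟩
    refine ⟨K, fun x hx => ?_⟩
    have h := hK.dist_le_mul x hx 0 (mem_Iic.2 le_rfl)
    rwa [hμ.apply_zero, dist_zero_right, Real.dist_eq, sub_zero] at h
  tfae_have 4 → 3 := fun ⟨_, hL⟩ => Hirsch.lintegral_lt_top_of_norm_le hμ hL
  tfae_have 3 → 1 := fun h => Hirsch.isOperatorLipschitzOn_of_integrable hμ.stieltjes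
    (Hirsch.lintegral_ofReal_lt_top_iff_integrable.1 h)
  tfae_have 3 → 2 := fun h => ⟨_, Hirsch.tendsto_deriv_of_integrable hμ
    (Hirsch.lintegral_ofReal_lt_top_iff_integrable.1 h)⟩
  tfae_have 2 → 3 := fun ⟨_, hl⟩ => Hirsch.lintegral_lt_top_of_tendsto_deriv hμ hl
  tfae_finish
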